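/- Let $G$ be an infinite compact Hausdorff abelian topological group. For an abelian topological group $H$, let $\widehat{H}$ denote the group of all continuous homomorphisms $H\to\mathbb{T}$ into the circle group $\mathbb{T}=\mathbb{R}/\mathbb{Z}$, endowed with the compact-open topology. A subgroup $D$ of $G$ (with the subspace topology) is said to determine $G$ if the restriction homomorphism $r:\widehat{G}\to\widehat{D}$, $r(\chi)=\chi\restriction_D$, is an isomorphism of topological groups, that is, both a group isomorphism and a homeomorphism. The weight $w(G)$ is the smallest cardinality of a base of the topology of $G$. If a subgroup $D$ of $G$ determines $G$, then $|D|\ge w(G)$. -/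

import Mathlib

open Topology TopologicalSpace

noncomputable section

/-- The weight of a topological space: the smallest cardinality of a base of its topology. -/
def weight (X : Type*) [TopologicalSpace X] : Cardinal :=
  sInf {κ | ∃ B : Set (Set X), IsTopologicalBasis B ∧ Cardinal.mk B = κ}

/-- The restriction homomorphism `χ ↦ χ|_D` from the dual of `G` to the dual of the subgroup `D`
(with the subspace topology). Both duals carry the compact-open topology. -/
def dualRestrict {G : Type*} [CommGroup G] [TopologicalSpace G] (D : Subgroup G) :
    PontryaginDual G →ₜ* PontryaginDual D :=
  PontryaginDual.map { toMonoidHom := D.subtype, continuous_toFun := continuous_subtype_val }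

/-- The subgroup `D` determines `G`: the restriction homomorphism is an isomorphism of
topological groups, that is, a bijective homomorphism which is a homeomorphism. -/
def Determines {G : Type*} [CommGroup G] [TopologicalSpace G] (D : Subgroup G) : Prop :=
  IsHomeomorph (dualRestrict D)

end

/-! Compactness of `G` makes its dual discrete, so if `D` determines `G` the dual of `D` is discrete
too: some compact `K` in `D` and `ε > 0` isolate the trivial character. Hence distinct characters of
`G` are `ε`-separated somewhere on `K`, and `mk_le_of_uniformly_separated` bounds their number by
`max ℵ₀ w(K)`, thus by `max ℵ₀ |K|`. Characters separate the points of `G`, so `w(G)` is at most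
`ℵ₀` or the size of the dual. Finally `D` is infinite, which absorbs `ℵ₀`. Separation of points
comes from Gelfand theory on the commutative bicommutant of the regular representation. -/

open MeasureTheory in
/-- The operator `∫ f(y) U(y) dμ(y)` attached to a continuous function `f` on a compact group and a
strongly continuous unitary representation `U`. -/
noncomputable def integratedRep {G H : Type*} [CommGroup G] [TopologicalSpace G] [CompactSpace G]
    [MeasurableSpace G] [BorelSpace G] (μ : Measure G) [IsProbabilityMeasure μ]
    [NormedAddCommGroup H] [InnerProductSpace ℂ H] [CompleteSpace H]
    (U : G →* unitary (H →L[ℂ] H)) (hU : ∀ h, Continuous fun x => (U x : H →L[ℂ] H) h) :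
    C(G, ℂ) →L[ℂ] H →L[ℂ] H :=
  have hint (f : C(G, ℂ)) (h : H) : Integrable (fun y => f y • (U y : H →L[ℂ] H) h) μ :=
    (f.continuous.smul (hU h)).integrable_of_hasCompactSupport (.of_compactSpace _)
  LinearMap.mkContinuous₂
    (LinearMap.mk₂ ℂ (fun f h => ∫ y, f y • (U y : H →L[ℂ] H) h ∂μ)
      (fun f g h => by
        simp only [ContinuousMap.add_apply, add_smul]
        exact integral_add (hint f h) (hint g h))
      (fun c f h => by
        simp only [ContinuousMap.smul_apply, smul_assoc]
        exact integral_smul c _)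
      (fun f h k => by
        simp only [map_add, smul_add]
        exact integral_add (hint f h) (hint f k))
      (fun c f h => by
        simp only [map_smul, smul_comm _ c]
        exact integral_smul c _))
    1 (fun f h => by
      refine (norm_integral_le_of_norm_le_const (C := ‖f‖ * ‖h‖) (.of_forall fun y => ?_)).trans ?_
      · rw [norm_smul, Unitary.norm_map (U y)]
        gcongr
        exact f.norm_coe_le_norm y
      · simp)

section integratedRep

open MeasureTheory

variable {G H : Type*} [CommGroup G] [TopologicalSpace G] [CompactSpace G]
    [MeasurableSpace G] [BorelSpace G] {μ : Measure G} [IsProbabilityMeasure μ]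
    [NormedAddCommGroup H] [InnerProductSpace ℂ H] [CompleteSpace H]
    {U : G →* unitary (H →L[ℂ] H)} (hU : ∀ h, Continuous fun x => (U x : H →L[ℂ] H) h)

include hU in
theorem integrable_smul_rep (f : C(G, ℂ)) (h : H) :
    Integrable (fun y => f y • (U y : H →L[ℂ] H) h) μ :=
  (f.continuous.smul (hU h)).integrable_of_hasCompactSupport (.of_compactSpace _)

theorem integratedRep_apply (f : C(G, ℂ)) (h : H) :
    integratedRep μ U hU f h = ∫ y, f y • (U y : H →L[ℂ] H) h ∂μ := rfl

/-- A bounded operator commuting with a representation commutes with the integrated operators. -/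
theorem integratedRep_comm (f : C(G, ℂ)) (b : H →L[ℂ] H)
    (hb : ∀ x, (U x : H →L[ℂ] H) * b = b * U x) :
    b * integratedRep μ U hU f = integratedRep μ U hU f * b := by
  ext h
  simp only [mul_apply_eq_comp, integratedRep_apply]
  rw [← ContinuousLinearMap.integral_comp_comm b (integrable_smul_rep hU f h)]
  refine integral_congr_ae (.of_forall fun y => ?_)
  simp only [map_smul]
  congr 1
  exact congr($(hb y) h).symm

/-- Invariance of `μ` moves the translation onto `f`. The right side is norm continuous in `x`,
although `U` is only strongly continuous. -/
theorem integratedRep_mul_rep [IsTopologicalGroup G] [μ.IsMulLeftInvariant] (f : C(G, ℂ)) (x : G) :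
    integratedRep μ U hU f * U x =
      integratedRep μ U hU ⟨fun y => f (x⁻¹ * y), by fun_prop⟩ := by
  ext h
  simp only [mul_apply_eq_comp, integratedRep_apply, ContinuousMap.coe_mk]
  rw [← integral_mul_left_eq_self (fun y => f (x⁻¹ * y) • (U y : H →L[ℂ] H) h) x]
  refine integral_congr_ae (.of_forall fun y => ?_)
  simp only [inv_mul_cancel_left]
  rw [mul_comm x y, map_mul]
  rfl

/-- Every nonzero vector is moved away from zero by some integrated operator. -/
theorem exists_integratedRep_ne_zero [μ.IsOpenPosMeasure] {k : H} (hk : k ≠ 0) :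
    ∃ f, integratedRep μ U hU f k ≠ 0 := by
  -- With the conjugate matrix coefficient of `k`, the pairing of `k` with its image is `∫ ‖f‖²`,
  -- positive since `f 1 = ‖k‖²`.
  let f : C(G, ℂ) := ⟨fun y => star (inner ℂ k ((U y : H →L[ℂ] H) k)), by
    have := hU k
    fun_prop⟩
  refine ⟨f, fun h0 => ?_⟩
  have h1 : inner ℂ k (integratedRep μ U hU f k) = ((∫ y, ‖f y‖ ^ 2 ∂μ : ℝ) : ℂ) := by
    rw [integratedRep_apply, ← integral_inner (integrable_smul_rep hU f k)]
    refine Eq.trans ?_ integral_ofReal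
    refine integral_congr_ae (.of_forall fun y => ?_)
    simp only [inner_smul_right, f, ContinuousMap.coe_mk, norm_star]
    simpa using RCLike.conj_mul (inner ℂ k ((U y : H →L[ℂ] H) k))
  rw [h0, inner_zero_right, eq_comm, Complex.ofReal_eq_zero] at h1
  have hc : Continuous fun y => ‖f y‖ ^ 2 := by fun_prop
  have h2 := (integral_eq_zero_iff_of_nonneg (fun y => by positivity)
    (hc.integrable_of_hasCompactSupport (.of_compactSpace _))).1 h1
  have h3 := congrFun ((hc.ae_eq_iff_eq μ continuous_zero).1 h2) 1
  simp [f, hk] at h3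

end integratedRep

/-- The bicommutant of a commutative family closed under `star` is a commutative C⋆-algebra, so its
characters detect nonzero elements. -/
theorem exists_character_bicommutant {A : Type*} [CStarAlgebra A] {S : Set A}
    (hS : ∀ a ∈ S, ∀ b ∈ S, a * b = b * a) (hstar : star S = S) :
    ∀ a ∈ StarSubalgebra.centralizer ℂ (StarSubalgebra.centralizer ℂ S : Set A), a ≠ 0 →
      ∃ φ : StarSubalgebra.centralizer ℂ (StarSubalgebra.centralizer ℂ S : Set A) →⋆ₐ[ℂ] ℂ,
        Continuous φ ∧ ∀ h, φ ⟨a, h⟩ ≠ 0 := by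
  intro a ha h0
  let B := StarSubalgebra.centralizer ℂ (StarSubalgebra.centralizer ℂ S : Set A)
  have hclosed : IsClosed (B : Set A) := Set.isClosed_centralizer _
  let : CommCStarAlgebra B :=
    { StarSubalgebra.cstarAlgebra B with
      mul_comm := fun x y => Subtype.ext <| by
        have hx := x.2
        have hy := y.2
        simp only [B] at hx hy
        rw [← SetLike.mem_coe, StarSubalgebra.coe_centralizer_centralizer, hstar,
          Set.union_self] at hx hy
        exact Set.centralizer_centralizer_comm_of_comm hS _ hx _ hy }
  have hne : WeakDual.gelfandTransform ℂ B ⟨a, ha⟩ ≠ 0 := by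
    rw [← map_zero (WeakDual.gelfandTransform ℂ B)]
    exact fun h => h0 congr(($((gelfandTransform_isometry B).injective h) : A))
  obtain ⟨φ, hφ⟩ := DFunLike.ne_iff.1 hne
  exact ⟨⟨(WeakDual.CharacterSpace.equivAlgHom φ : B →ₐ[ℂ] ℂ), fun x => map_star φ x⟩,
    map_continuous φ, fun h => hφ⟩

open MeasureTheory in
/-- An element acting nontrivially in a strongly continuous unitary representation of a compact
commutative group is detected by a character. -/
theorem exists_pontryaginDual_ne_one_of_rep {G H : Type*} [CommGroup G] [TopologicalSpace G]
    [IsTopologicalGroup G] [CompactSpace G]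
    [MeasurableSpace G] [BorelSpace G] (μ : Measure G) [IsProbabilityMeasure μ]
    [μ.IsMulLeftInvariant] [μ.IsOpenPosMeasure]
    [NormedAddCommGroup H] [InnerProductSpace ℂ H] [CompleteSpace H]
    (U : G →* unitary (H →L[ℂ] H)) (hU : ∀ h, Continuous fun x => (U x : H →L[ℂ] H) h)
    {g : G} (hg : U g ≠ 1) : ∃ χ : PontryaginDual G, χ g ≠ 1 := by
  let S : Set (H →L[ℂ] H) := Set.range fun x => (U x : H →L[ℂ] H)
  have hS : ∀ a ∈ S, ∀ b ∈ S, a * b = b * a := by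
    rintro _ ⟨x, rfl⟩ _ ⟨y, rfl⟩
    simp only [← Submonoid.coe_mul, ← map_mul, mul_comm]
  have hinv (x : G) : star (U x : H →L[ℂ] H) = U x⁻¹ := by
    rw [map_inv]; rfl
  have hstar : star S = S := by
    ext a
    rw [Set.mem_star]
    constructor
    · rintro ⟨x, hx⟩
      exact ⟨x⁻¹, by simp only [← hinv, hx, star_star]⟩
    · rintro ⟨x, rfl⟩
      exact ⟨x⁻¹, by simp only [← hinv]⟩
  let B := StarSubalgebra.centralizer ℂ (StarSubalgebra.centralizer ℂ S : Set (H →L[ℂ] H))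
  have hmem (b : H →L[ℂ] H) (hb : ∀ c : H →L[ℂ] H,
      (∀ x, (U x : H →L[ℂ] H) * c = c * U x) → c * b = b * c) : b ∈ B := by
    simp only [B]
    rw [← SetLike.mem_coe, StarSubalgebra.coe_centralizer_centralizer, hstar, Set.union_self]
    exact fun c hc => hb c fun x => hc _ ⟨x, rfl⟩
  let T := integratedRep μ U hU
  have hT (f) : T f ∈ B := hmem _ fun c hc => integratedRep_comm hU f c hc
  have hUB (x) : (U x : H →L[ℂ] H) ∈ B := hmem _ fun c hc => (hc x).symm
  obtain ⟨h, hh⟩ : ∃ h, (U g : H →L[ℂ] H) h - h ≠ 0 := by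
    by_contra! hc
    exact hg (Subtype.ext (ContinuousLinearMap.ext fun h => sub_eq_zero.1 (hc h)))
  obtain ⟨f, hf⟩ := exists_integratedRep_ne_zero (μ := μ) hU hh
  -- The factor `T f` guarantees `φ (T f) ≠ 0`; dividing by it later gives continuity of `x ↦ φ (U
  -- x)`.
  obtain ⟨φ, hφc, hφ⟩ := exists_character_bicommutant hS hstar (T f * ((U g : H →L[ℂ] H) - 1))
    (B.mul_mem (hT f) (B.sub_mem (hUB g) B.one_mem)) fun h0 => hf congr($h0 h)
  replace hφ := hφ (B.mul_mem (hT f) (B.sub_mem (hUB g) B.one_mem))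
  let u : G →* B :=
    { toFun := fun x => ⟨U x, hUB x⟩
      map_one' := Subtype.ext (by simp)
      map_mul' := fun x y => Subtype.ext (by simp) }
  have key : φ ⟨T f, hT f⟩ * (φ (u g) - 1) ≠ 0 := by
    rw [← map_one φ, ← map_sub, ← map_mul]
    exact hφ
  have hTf := left_ne_zero_of_mul key
  have hnorm (x : G) : φ (u x) ∈ Submonoid.unitSphere ℂ := by
    have h1 : star (u x) * u x = 1 := Subtype.ext (Unitary.coe_star_mul_self (U x))
    have h2 := congr(φ $h1)
    rw [map_mul, map_star, map_one] at h2
    have h3 : ‖φ (u x)‖ * ‖φ (u x)‖ = 1 := by simpa using congr(‖$h2‖)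
    rw [← SetLike.mem_coe, Submonoid.coe_unitSphere, mem_sphere_zero_iff_norm]
    nlinarith [norm_nonneg (φ (u x))]
  have hcont : Continuous fun x => φ (u x) := by
    let F : C(G × G, ℂ) := ⟨fun p => f (p.1⁻¹ * p.2), by fun_prop⟩
    have h1 : Continuous fun x => φ ⟨T (F.curry x), hT _⟩ :=
      hφc.comp ((T.continuous.comp F.curry.continuous).subtype_mk _)
    have h2 (x : G) : φ (u x) = (φ ⟨T f, hT f⟩)⁻¹ * φ ⟨T (F.curry x), hT _⟩ := by
      rw [eq_inv_mul_iff_mul_eq₀ hTf, ← map_mul]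
      exact congrArg φ (Subtype.ext (integratedRep_mul_rep hU f x))
    simp only [h2]
    exact continuous_const.mul h1
  let χ : G →ₜ* Circle :=
    { toFun := fun x => ⟨φ (u x), hnorm x⟩
      map_one' := Subtype.ext ((congrArg φ (map_one u)).trans (map_one φ))
      map_mul' := fun x y => Subtype.ext ((congrArg φ (map_mul u x y)).trans (map_mul φ _ _))
      continuous_toFun := hcont.subtype_mk _ }
  refine ⟨χ, fun h => right_ne_zero_of_mul key ?_⟩
  rw [sub_eq_zero]
  exact congr(($h : ℂ))

/-! ### Cardinality of bases and of separated families -/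

section basis

open Cardinal

universe u

theorem mk_finset_le_max (α : Type u) : #(Finset α) ≤ max ℵ₀ #α := by
  cases finite_or_infinite α
  · exact (mk_le_aleph0 (α := Finset α)).trans (le_max_left _ _)
  · rw [mk_finset_of_infinite]
    exact le_max_right _ _

/-- A compact space with a point-separating family of continuous maps into a second countable
Hausdorff space has a base no larger than the family, up to countable sets. -/
theorem exists_basis_of_separating {X ι : Type u} {Y : Type*} [TopologicalSpace X] [CompactSpace X]
    [TopologicalSpace Y] [T2Space Y] [SecondCountableTopology Y]
    [Nonempty Y] (f : ι → C(X, Y))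
    (hf : ∀ a b, a ≠ b → ∃ i, f i a ≠ f i b) :
    ∃ B : Set (Set X), IsTopologicalBasis B ∧ #B ≤ max ℵ₀ #ι := by
  -- Only the nonemptiness of the countable base is needed, to enumerate it by `ℕ`.
  obtain ⟨b, hb, -⟩ := (isBasis_countableBasis Y).exists_subset_of_mem_open
    (Set.mem_univ (Classical.arbitrary Y)) isOpen_univ
  obtain ⟨e, he⟩ := (countable_countableBasis Y).exists_eq_range ⟨b, hb⟩
  have hemb : IsEmbedding fun (x : X) (i : ι) => f i x :=
    (Continuous.isClosedEmbedding (by fun_prop) fun a b hab => by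
      by_contra hne
      obtain ⟨i, hi⟩ := hf a b hne
      exact hi (congrFun hab i)).isEmbedding
  let s : Set (Set X) := Set.range fun p : ι × ℕ => f p.1 ⁻¹' e p.2
  have hs : ‹TopologicalSpace X› = generateFrom s := by
    rw [hemb.eq_induced, Pi.topologicalSpace, induced_iInf]
    simp only [(isBasis_countableBasis Y).eq_generateFrom,
      induced_generateFrom_eq, ← generateFrom_iUnion, he]
    congr 1
    ext t
    simp [s, Set.preimage_preimage]
  refine ⟨_, isTopologicalBasis_of_subbasis hs, ?_⟩
  have hsub : ((fun f => ⋂₀ f) '' {f : Set (Set X) | f.Finite ∧ f ⊆ s}) ⊆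
      Set.range fun t : Finset (ι × ℕ) => ⋂ p ∈ t, f p.1 ⁻¹' e p.2 := by
    classical
    rintro _ ⟨g, ⟨hg, hgs⟩, rfl⟩
    rw [show s = _ from Set.image_univ.symm] at hgs
    obtain ⟨t, -, ht, rfl⟩ := Set.exists_subset_image_finite_and (p := fun g' => g' = g) |>.1
      ⟨g, hgs, hg, rfl⟩
    exact ⟨ht.toFinset, by simp [Set.sInter_image]⟩
  refine (mk_le_mk_of_subset hsub).trans (mk_range_le.trans ((mk_finset_le_max _).trans ?_))
  refine max_le (le_max_left _ _) ?_
  simpa [mul_comm, or_comm] using mul_le_max_of_aleph0_le_left (b := #ι) le_rfl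

/-- A family of continuous functions on a compact space whose members are pairwise uniformly `ε`
apart is no larger than a base of the space, up to countable sets. -/
theorem mk_le_of_uniformly_separated {X F : Type u} {Y : Type*} [TopologicalSpace X]
    [CompactSpace X] [PseudoMetricSpace Y] [SeparableSpace Y] [Nonempty Y] {B : Set (Set X)}
    (hB : IsTopologicalBasis B) (ev : F → C(X, Y)) {ε : ℝ} (hε : 0 < ε)
    (hF : ∀ φ ψ, (∀ x, dist (ev φ x) (ev ψ x) < ε) → φ = ψ) : #F ≤ max ℵ₀ #B := by
  classical
  -- Each function is encoded by a finite set of pairs (basic set, approximate value); tolerance `ε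
  -- / 2` makes functions with equal codes `ε`-close.
  have hex (φ : F) : ∃ t : Finset (B × ℕ), (∀ x, ∃ p ∈ t, x ∈ p.1.1) ∧
      ∀ p ∈ t, ∀ x ∈ p.1.1, dist (ev φ x) (denseSeq Y p.2) < ε / 2 := by
    have h1 (x : X) : ∃ p : B × ℕ, x ∈ p.1.1 ∧
        ∀ y ∈ p.1.1, dist (ev φ y) (denseSeq Y p.2) < ε / 2 := by
      obtain ⟨n, hn⟩ := (denseRange_denseSeq Y).exists_dist_lt (ev φ x) (half_pos hε)
      obtain ⟨b, hb, hxb, hsub⟩ := hB.exists_subset_of_mem_open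
        (u := {y | dist (ev φ y) (denseSeq Y n) < ε / 2}) hn
        (isOpen_lt (by fun_prop) (by fun_prop))
      exact ⟨⟨⟨b, hb⟩, n⟩, hxb, hsub⟩
    choose p hp hp' using h1
    obtain ⟨t, ht⟩ := isCompact_univ.elim_finite_subcover (fun x => ((p x).1 : Set X))
      (fun x => hB.isOpen (p x).1.2) fun x _ => Set.mem_iUnion.2 ⟨x, hp x⟩
    refine ⟨t.image p, fun x => ?_, ?_⟩
    · obtain ⟨y, hy, hxy⟩ := Set.mem_iUnion₂.1 (ht (Set.mem_univ x))
      exact ⟨p y, Finset.mem_image_of_mem _ hy, hxy⟩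
    · simp only [Finset.forall_mem_image]
      exact fun x _ => hp' x
  choose t ht ht' using hex
  have hinj : Function.Injective t := fun φ ψ h => hF φ ψ fun x => by
    obtain ⟨p, hp, hx⟩ := ht φ x
    have h1 := ht' φ p hp x hx
    have h2 := ht' ψ p (h ▸ hp) x hx
    have h3 := dist_triangle_right (ev φ x) (ev ψ x) (denseSeq Y p.2)
    linarith
  refine (mk_le_of_injective hinj).trans ((mk_finset_le_max _).trans ?_)
  refine max_le (le_max_left _ _) ?_
  simpa [mul_comm, or_comm] using mul_le_max_of_aleph0_le_left (b := #B) le_rfl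

/-- A compact Hausdorff space has a base no larger than the space, up to countable sets. -/
theorem exists_basis_mk_le (X : Type u) [TopologicalSpace X] [CompactSpace X] [T2Space X] :
    ∃ B : Set (Set X), IsTopologicalBasis B ∧ #B ≤ max ℵ₀ #X := by
  have hsep (p : {p : X × X // p.1 ≠ p.2}) : ∃ f : C(X, ℝ), f p.1.1 ≠ f p.1.2 := by
    obtain ⟨f, h0, h1, -⟩ := exists_continuous_zero_one_of_isClosed (isClosed_singleton (x := p.1.1))
      (isClosed_singleton (x := p.1.2)) (Set.disjoint_singleton.2 p.2)
    exact ⟨f, by simp [h0 rfl, h1 rfl]⟩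
  choose f hf using hsep
  obtain ⟨B, hB, hcard⟩ := exists_basis_of_separating f fun a b h => ⟨⟨(a, b), h⟩, hf _⟩
  refine ⟨B, hB, hcard.trans (max_le (le_max_left _ _) ((mk_subtype_le _).trans ?_))⟩
  rw [mk_prod, lift_id]
  exact (mul_le_max _ _).trans (by simp [max_comm])

end basis

/-! ### The regular representation and separation of points -/

section regularRep

open MeasureTheory DomMulAct

variable {G : Type*} [CommGroup G] [TopologicalSpace G] [IsTopologicalGroup G]
    [MeasurableSpace G] [BorelSpace G] (μ : Measure G) [μ.IsMulLeftInvariant]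

/-- The regular representation of a commutative group on `L²`. -/
noncomputable def regularRep : G →* unitary (Lp ℂ 2 μ →L[ℂ] Lp ℂ 2 μ) :=
  Unitary.linearIsometryEquiv.symm.toMonoidHom.comp
    { toFun := fun x =>
        { toFun := fun h => mk x • h
          invFun := fun h => mk x⁻¹ • h
          map_add' := smul_Lp_add _
          map_smul' := fun c h => smul_comm _ c h
          left_inv := fun h => inv_smul_smul (mk x) h
          right_inv := fun h => smul_inv_smul (mk x) h
          norm_map' := norm_smul_Lp _ }
      map_one' := by
        ext1 h
        exact one_smul Gᵈᵐᵃ h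
      map_mul' := fun x y => by
        ext1 h
        -- `mk` reverses products, so commutativity is used here.
        change mk (x * y) • h = mk x • mk y • h
        rw [smul_smul, ← mk_mul, mul_comm] }

theorem regularRep_apply (x : G) (h : Lp ℂ 2 μ) :
    (regularRep μ x : Lp ℂ 2 μ →L[ℂ] Lp ℂ 2 μ) h = mk x • h := rfl

end regularRep

open MeasureTheory in
/-- The characters of a compact commutative group separate its points. -/
theorem exists_pontryaginDual_apply_ne_one {G : Type*} [CommGroup G] [TopologicalSpace G]
    [IsTopologicalGroup G] [T2Space G] [CompactSpace G] {g : G} (hg : g ≠ 1) :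
    ∃ χ : PontryaginDual G, χ g ≠ 1 := by
  borelize G
  let μ : Measure G := Measure.haarMeasure ⊤
  have : IsProbabilityMeasure μ :=
    ⟨by simpa using Measure.haarMeasure_self (K₀ := (⊤ : PositiveCompacts G))⟩
  refine exists_pontryaginDual_ne_one_of_rep μ (regularRep μ) (fun h => ?_) (g := g) fun h1 => ?_
  · simp only [regularRep_apply]
    have : Fact ((2 : ENNReal) ≠ ⊤) := ⟨by simp⟩
    exact (DomMulAct.continuous_mk).smul continuous_const
  · obtain ⟨f, h0, h1', -⟩ := exists_continuous_zero_one_of_isClosed (isClosed_singleton (x := g))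
      (isClosed_singleton (x := 1)) (Set.disjoint_singleton.2 hg)
    let F : C(G, ℂ) := ⟨fun x => f x, by fun_prop⟩
    have h2 := congr(($h1 : Lp ℂ 2 μ →L[ℂ] Lp ℂ 2 μ) (ContinuousMap.toLp 2 μ ℂ F))
    rw [regularRep_apply] at h2
    have h3 : DomMulAct.mk g • ContinuousMap.toLp 2 μ ℂ F =
        ContinuousMap.toLp 2 μ ℂ (⟨fun x => F (g * x), by fun_prop⟩ : C(G, ℂ)) := rfl
    rw [h3] at h2
    have h4 := ContinuousMap.toLp_injective μ (h2 : _ = ContinuousMap.toLp 2 μ ℂ F)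
    have h5 := congr($h4 1)
    simp [F, h0 rfl, h1' rfl] at h5

/-! ### Determining subgroups -/

theorem Circle.dist_one_div (a b : Circle) : dist 1 (a / b) = dist b a := by
  have h : (1 : ℂ) - a / b = (b - a) / b := by field_simp [b.coe_ne_zero]
  change dist ((1 : Circle) : ℂ) ((a / b : Circle) : ℂ) = dist (b : ℂ) a
  rw [dist_eq_norm, dist_eq_norm]
  rw [Circle.coe_one, Circle.coe_div, h, norm_div, Circle.norm_coe, div_one]

/-- If the dual is discrete, then the trivial character is isolated by a compact set. -/
theorem PontryaginDual.exists_uniform_discreteness {D : Type*} [CommGroup D] [TopologicalSpace D]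
    [DiscreteTopology (PontryaginDual D)] :
    ∃ K : Set D, IsCompact K ∧ ∃ ε > 0, ∀ χ : PontryaginDual D,
      (∀ x ∈ K, dist (1 : Circle) (χ x) < ε) → χ = 1 := by
  have h1 : ({1} : Set (PontryaginDual D)) ∈ 𝓝 1 := (isOpen_discrete _).mem_nhds rfl
  have h2 : 𝓝 (1 : PontryaginDual D) = Filter.comap
      (fun χ : D →ₜ* Circle => (χ : C(D, Circle))) (𝓝 ((1 : D →ₜ* Circle) : C(D, Circle))) :=
    nhds_induced _ _
  rw [h2] at h1
  obtain ⟨t, ht, hsub⟩ := Filter.mem_comap.1 h1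
  obtain ⟨⟨K, ε⟩, ⟨hK, hε⟩, hKε⟩ := (nhds_basis_uniformity'
    ((Metric.uniformity_basis_dist (α := Circle)).compactConvergenceUniformity (α := D))).mem_iff.1 ht
  exact ⟨K, hK, ε, hε, fun χ hχ => hsub (hKε fun x hx => hχ x hx)⟩

/-- A finite `D` would be closed and proper, so a nontrivial character of `G ⧸ D` would pull back to
a nontrivial character of `G` killed by restriction. -/
theorem Determines.infinite {G : Type*} [CommGroup G] [TopologicalSpace G] [IsTopologicalGroup G]
    [T2Space G] [CompactSpace G] [Infinite G] {D : Subgroup G} (hD : Determines D) :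
    Infinite D := by
  by_contra hfin
  rw [not_infinite_iff_finite] at hfin
  have : IsClosed (D : Set G) := (Set.toFinite (D : Set G)).isClosed
  obtain ⟨g, hg⟩ : ∃ g, g ∉ D := by
    by_contra! h
    exact not_finite_iff_infinite.2 ‹Infinite G›
      (Finite.of_surjective (Subtype.val : D → G) fun g => ⟨⟨g, h g⟩, rfl⟩)
  obtain ⟨χ, hχ⟩ := exists_pontryaginDual_apply_ne_one (G := G ⧸ D) (g := (g : G ⧸ D))
    (by simpa using hg)
  let π : G →ₜ* G ⧸ D := { toMonoidHom := QuotientGroup.mk' D, continuous_toFun := continuous_quot_mk }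
  have h1 : PontryaginDual.map π χ = 1 := hD.injective <| by
    ext1 d
    have h2 : ((d : G) : G ⧸ D) = 1 := (QuotientGroup.eq_one_iff _).2 d.2
    change χ ((d : G) : G ⧸ D) = 1
    rw [h2, map_one]
  exact hχ congr($h1 g)

open Cardinal in
theorem mainTheorem4 {G : Type*} [CommGroup G] [TopologicalSpace G] [IsTopologicalGroup G]
    [T2Space G] [CompactSpace G] [Infinite G] (D : Subgroup G) (hD : Determines D) :
    weight G ≤ Cardinal.mk D := by
  have := hD.infinite
  have : DiscreteTopology (PontryaginDual D) := (hD.homeomorph _).symm.isEmbedding.discreteTopology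
  obtain ⟨K, hK, ε, hε, hKε⟩ := PontryaginDual.exists_uniform_discreteness (D := D)
  have : CompactSpace K := isCompact_iff_compactSpace.1 hK
  obtain ⟨B, hB, hBK⟩ := exists_basis_mk_le K
  have hdual : #(PontryaginDual G) ≤ max ℵ₀ #B := by
    refine mk_le_of_uniformly_separated hB (Y := Circle)
      (fun χ => ⟨fun x => χ (x : D), by fun_prop⟩) hε fun χ ψ h => ?_
    rw [← div_eq_one]
    -- It suffices that `χ / ψ` is trivial on `D`, which follows from its being `ε`-close to `1` on
    -- `K`.
    refine hD.injective ((hKε _ fun x hx => ?_).trans (map_one _).symm)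
    change dist (1 : Circle) (χ (x : G) * (ψ (x : G))⁻¹) < ε
    have h1 := h ⟨x, hx⟩
    rw [dist_comm] at h1
    rw [← div_eq_mul_inv, Circle.dist_one_div]
    exact h1
  obtain ⟨C, hC, hCG⟩ := exists_basis_of_separating
    (fun χ : PontryaginDual G => (⟨χ, by fun_prop⟩ : C(G, Circle))) fun a b hab => by
      obtain ⟨χ, hχ⟩ := exists_pontryaginDual_apply_ne_one (div_ne_one.2 hab)
      exact ⟨χ, fun h => hχ (by rw [map_div, div_eq_one]; exact h)⟩
  have hω : ℵ₀ ≤ #D := aleph0_le_mk D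
  have hKD : #K ≤ #D := mk_set_le K
  calc weight G ≤ #C := csInf_le' ⟨C, hC, rfl⟩
    _ ≤ #D := hCG.trans (max_le hω (hdual.trans (max_le hω (hBK.trans (max_le hω hKD)))))
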